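/- Let $k$ be a positive integer and $N>0$. The $k$-user Gaussian multiple access channel (MAC) with noise variance $N$ has inputs $x_{[k]}=(x_1,\dots,x_k)\in\mathbb{R}^k$, output $y\in\mathbb{R}$, and transition density $$p(y|x_{[k]})=\frac{1}{\sqrt{2\pi N}}\exp\Big[-\frac{1}{2N}\Big(y-\sum_{j=1}^k x_j\Big)^2\Big].$$ For a power constraint vector $\mathbf{P}=(P_j)_{j=1}^k\in\mathbb{R}^k_{\ge 0}$, let $\mathcal{P}$ be the set of all (Borel) probability distributions of $X_{[k]}=(X_1,\dots,X_k)$ on $\mathbb{R}^k$ with $\mathbb{E}[X_j^2]\le P_j$ for all $j$, and let $\mathcal{P}_{\mathrm{ind}}\subseteq\mathcal{P}$ be the set of those under which $X_1,\dots,X_k$ are independent. For $p\in\mathcal{P}$ write $I_p(X_{[k]};Y)$ for the mutual information between input and output and $p(y)$ for the output distribution when the input distribution is $p$, and let $D(\cdot\|\cdot)$ denote the Kullback–Leibler divergence. The channel with power constraint vector $\mathbf{P}$ is said to be in the class $\mathcal{C}^*(\mathbb{R}^k,\mathbb{R})$ if there exist $p_{\mathrm{ind}}\in\mathcal{P}_{\mathrm{ind}}$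 with $$I_{p_{\mathrm{ind}}}(X_{[k]};Y)=\max_{p\in\mathcal{P}_{\mathrm{ind}}}I_p(X_{[k]};Y)$$ and $p_{\mathrm{dep}}\in\mathcal{P}$ whose support is contained in the support of $p_{\mathrm{ind}}$ such that $$I_{p_{\mathrm{dep}}}(X_{[k]};Y)+D\big(p_{\mathrm{dep}}(y)\,\|\,p_{\mathrm{ind}}(y)\big)>I_{p_{\mathrm{ind}}}(X_{[k]};Y).$$ Then, for every $N>0$ and every $\mathbf{P}\in\mathbb{R}^k_{\ge 0}$, the $k$-user Gaussian MAC with power constraint vector $\mathbf{P}$ is in $\mathcal{C}^*(\mathbb{R}^k,\mathbb{R})$ if and only if at least two entries of $\mathbf{P}$ are positive. -/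

import Mathlib

open MeasureTheory ProbabilityTheory InformationTheory
open scoped ENNReal NNReal

noncomputable section

/-- A memoryless `k`-user multiple access channel (MAC) without feedback, with input alphabets
`X 0, …, X (k - 1)` and output alphabet `Y`. It is given by its one-letter transition
probabilities `p(y | x_[k])`, a Markov kernel from `∏ j, X j` to `Y`. (Discrete MACs are the case
of countable alphabets with all subsets measurable; continuous MACs are built
by `MAC.ofDensity` below.) -/
structure MAC {k : ℕ} (X : Fin k → Type*) (Y : Type*) [∀ j, MeasurableSpace (X j)]
    [MeasurableSpace Y] where
  /-- the conditional law of the channel output given the channel inputs -/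
  transition : Kernel (∀ j, X j) Y
  /-- the transition probabilities are probability measures -/
  isMarkov : IsMarkovKernel transition

namespace MAC

section General

variable {k : ℕ} {X : Fin k → Type*} {Y : Type*} [∀ j, MeasurableSpace (X j)] [MeasurableSpace Y]

/-- The output distribution `p(y)` when the input distribution is `p(x_[k])`. -/
def output (W : MAC X Y) (p : Measure (∀ j, X j)) : Measure Y :=
  W.transition ∘ₘ p

/-- The mutual information `I(X_[k]; Y)` (in nats) under the input distribution `p(x_[k])`:
the Kullback-Leibler divergence of the joint law of `(X_[k], Y)` from the product of its
marginals. -/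
def mutualInfo (W : MAC X Y) (p : Measure (∀ j, X j)) : ℝ≥0∞ :=
  klDiv (p ⊗ₘ W.transition) (p.prod (W.output p))

/-- The set `P(X_[k])` of all distributions on the input alphabet `∏ j, X j` that satisfy the cost
constraints `E[b_j(X_j)] ≤ B_j`. -/
def inputDists (b : ∀ j, X j → ℝ≥0) (B : Fin k → ℝ≥0) : Set (Measure (∀ j, X j)) :=
  {p | IsProbabilityMeasure p ∧ ∀ j, ∫⁻ x, (b j (x j) : ℝ≥0∞) ∂p ≤ (B j : ℝ≥0∞)}

/-- The set `P_ind(X_[k])` of all product distributions `∏ j, p(x_j)` on `∏ j, X j` that satisfy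
the cost constraints. -/
def indInputDists (b : ∀ j, X j → ℝ≥0) (B : Fin k → ℝ≥0) : Set (Measure (∀ j, X j)) :=
  {p | p ∈ inputDists b B ∧
    ∃ q : ∀ j, Measure (X j), (∀ j, IsProbabilityMeasure (q j)) ∧ p = Measure.pi q}

/-- The class `C*(X_[k], Y)` of MACs, for cost functions `b` and cost constraint vector `B`.
The support of a distribution is its topological support (for a discrete alphabet with the
discrete topology: the set of points of positive mass). -/
def cStar [∀ j, TopologicalSpace (X j)] (b : ∀ j, X j → ℝ≥0) (B : Fin k → ℝ≥0) :
    Set (MAC X Y) :=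
  {W | ∃ pInd ∈ indInputDists b B, ∃ pDep ∈ inputDists b B,
    IsGreatest (W.mutualInfo '' indInputDists b B) (W.mutualInfo pInd) ∧
    pDep.support ⊆ pInd.support ∧
    W.mutualInfo pInd < W.mutualInfo pDep + klDiv (W.output pDep) (W.output pInd)}

end General

/-- The continuous MAC on `ℝ^k` with conditional probability density `f x y = p(y | x_[k])`. -/
def ofDensity {k : ℕ} (f : (Fin k → ℝ) → ℝ → ℝ≥0∞) (hf : Measurable (Function.uncurry f))
    (hf_one : ∀ x, ∫⁻ y, f x y = 1) : MAC (fun _ : Fin k => ℝ) ℝ where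
  transition := Kernel.withDensity (Kernel.const _ volume) f
  isMarkov := ⟨fun x => ⟨by
    rw [Kernel.withDensity_apply' _ hf, Kernel.const_apply, Measure.restrict_univ, hf_one x]⟩⟩

/-- The transition density of the `k`-user Gaussian MAC with noise variance `N`. -/
def gaussianDensity (k : ℕ) (N : ℝ) (x : Fin k → ℝ) (y : ℝ) : ℝ :=
  1 / √(2 * Real.pi * N) * Real.exp (-(1 / (2 * N)) * (y - ∑ j, x j) ^ 2)

theorem measurable_gaussianDensity (k : ℕ) (N : ℝ) :
    Measurable (Function.uncurry fun (x : Fin k → ℝ) (y : ℝ) =>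
      ENNReal.ofReal (gaussianDensity k N x y)) := by
  unfold gaussianDensity Function.uncurry
  fun_prop

theorem gaussianDensity_eq_gaussianPDFReal (k : ℕ) {N : ℝ} (hN : 0 < N) (x : Fin k → ℝ) (y : ℝ) :
    gaussianDensity k N x y = gaussianPDFReal (∑ j, x j) N.toNNReal y := by
  rw [gaussianDensity, gaussianPDFReal, Real.coe_toNNReal N hN.le, one_div]
  congr 2
  ring

theorem lintegral_gaussianDensity (k : ℕ) {N : ℝ} (hN : 0 < N) (x : Fin k → ℝ) :
    ∫⁻ y, ENNReal.ofReal (gaussianDensity k N x y) = 1 := by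
  simp_rw [gaussianDensity_eq_gaussianPDFReal k hN]
  exact lintegral_gaussianPDFReal_eq_one _ (by simpa using hN)

/-- The `k`-user Gaussian MAC with noise variance `N > 0`. -/
def gaussian (k : ℕ) (N : ℝ) (hN : 0 < N) : MAC (fun _ : Fin k => ℝ) ℝ :=
  ofDensity (fun x y => ENNReal.ofReal (gaussianDensity k N x y))
    (measurable_gaussianDensity k N) (lintegral_gaussianDensity k hN)

/-- The cost functions `b_j(x) = x²`, whose cost constraints are power constraints. -/
def powerCost (k : ℕ) : Fin k → ℝ → ℝ≥0 :=
  fun _ x => ⟨x ^ 2, sq_nonneg x⟩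

end MAC

end

/-! Write `S = ∑ j, X j` and `V = ∑ j, P j + N`. For any law `q` on the output, `I_p + D(p(y) ‖ q)`
equals the divergence of the joint law from `p × q` (`klDiv_prod_comp_add_klDiv`). For `q = N(m, V)`
this is explicit (`klDiv_compProd_gaussian`): `½ log(V/N) - ½ + (N + E(S - m)²) / (2V)`. It depends
on `p` only through `E(S - m)²`, and is at most `½ log(V/N)` once `E(S - m)² ≤ ∑ j, P j`.

Independent inputs meet this bound with `m = E S`, since variances add; the product of the `N(0, P
j)` has output `N(0, V)` and attains it. So the maximum is `½ log(V/N)`.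

If two powers are positive, the point mass at `(√P j)` has `E S² = (∑ √P j)² > ∑ P j`, which breaks
the bound at `m = 0`. Otherwise the cross terms of `S²` vanish almost surely for every admissible
`p`, so the bound at `m = 0` holds for all of them. It also forces every maximizer to have output
`N(0, V)`, and the strict inequality is then impossible. -/

/-! ### Relative entropy and the compensation identity -/

theorem klDiv_map_measurableEquiv {α β : Type*} [MeasurableSpace α] [MeasurableSpace β]
    (μ ν : Measure α) [IsFiniteMeasure μ] [IsFiniteMeasure ν] (e : α ≃ᵐ β) :
    klDiv (μ.map e) (ν.map e) = klDiv μ ν := by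
  refine le_antisymm (klDiv_map_le μ ν e.measurable) ?_
  have h := klDiv_map_le (μ.map e) (ν.map e) e.symm.measurable
  simpa using h

/-- The compensation identity for mutual information. -/
theorem klDiv_prod_comp_add_klDiv {α β : Type*} [MeasurableSpace α] [MeasurableSpace β]
    [StandardBorelSpace α] [Nonempty α] [MeasurableSpace.CountableOrCountablyGenerated β α]
    (p : Measure α) [IsProbabilityMeasure p] (κ : Kernel α β) [IsMarkovKernel κ]
    (q : Measure β) [IsProbabilityMeasure q] :
    klDiv (p ⊗ₘ κ) (p.prod (κ ∘ₘ p)) + klDiv (κ ∘ₘ p) q = klDiv (p ⊗ₘ κ) (p.prod q) := by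
  -- Disintegrating over the output first, with the posterior as kernel, turns the identity into the
  -- chain rule.
  have hswap (r : Measure β) [IsProbabilityMeasure r] :
      klDiv ((κ ∘ₘ p) ⊗ₘ posterior κ p) (r ⊗ₘ Kernel.const β p) = klDiv (p ⊗ₘ κ) (p.prod r) := by
    rw [compProd_posterior_eq_map_swap, Measure.compProd_const, ← Measure.prod_swap]
    exact klDiv_map_measurableEquiv _ _ MeasurableEquiv.prodComm
  rw [← hswap, ← hswap, klDiv_compProd_eq_add (ν := q), add_comm]

namespace MAC

variable (k : ℕ) (N : ℝ) (hN : 0 < N)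

instance isMarkovKernel_transition {X : Fin k → Type*} {Y : Type*} [∀ j, MeasurableSpace (X j)]
    [MeasurableSpace Y] (W : MAC X Y) : IsMarkovKernel W.transition := W.isMarkov

instance isProbabilityMeasure_output {X : Fin k → Type*} {Y : Type*} [∀ j, MeasurableSpace (X j)]
    [MeasurableSpace Y] (W : MAC X Y) (p : Measure (∀ j, X j)) [IsProbabilityMeasure p] :
    IsProbabilityMeasure (W.output p) := by
  unfold output; infer_instance

theorem gaussian_transition_apply (x : Fin k → ℝ) :
    (gaussian k N hN).transition x = gaussianReal (∑ j, x j) N.toNNReal := by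
  rw [gaussianReal_of_var_ne_zero _ (by simpa using hN)]
  simp only [gaussian, ofDensity]
  rw [Kernel.withDensity_apply _ (measurable_gaussianDensity k N), Kernel.const_apply]
  congr 1
  ext y
  rw [gaussianDensity_eq_gaussianPDFReal k hN, gaussianPDF]

theorem mutualInfo_add_klDiv_output (p : Measure (Fin k → ℝ)) [IsProbabilityMeasure p]
    (q : Measure ℝ) [IsProbabilityMeasure q] :
    (gaussian k N hN).mutualInfo p + klDiv ((gaussian k N hN).output p) q =
      klDiv (p ⊗ₘ (gaussian k N hN).transition) (p.prod q) :=
  klDiv_prod_comp_add_klDiv p _ q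

end MAC

/-! ### Divergence of a Gaussian channel from a Gaussian reference output -/

theorem integrable_sub_sq_gaussianReal (μ a : ℝ) (v : ℝ≥0) :
    Integrable (fun y => (y - a) ^ 2) (gaussianReal μ v) :=
  ((memLp_id_gaussianReal 2).sub (memLp_const a)).integrable_sq

theorem integral_sub_sq_gaussianReal (μ a : ℝ) (v : ℝ≥0) :
    ∫ y, (y - a) ^ 2 ∂(gaussianReal μ v) = v + (μ - a) ^ 2 := by
  have h := variance_fun_id_gaussianReal (μ := μ) (v := v)
  have hm : MemLp (fun y : ℝ => y - a) 2 (gaussianReal μ v) :=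
    (memLp_id_gaussianReal 2).sub (memLp_const a)
  have hi : Integrable (fun y : ℝ => y) (gaussianReal μ v) :=
    memLp_one_iff_integrable.1 (memLp_id_gaussianReal 1)
  have h1 : ∫ y, (y - a) ∂(gaussianReal μ v) = μ - a := by
    rw [integral_sub hi (integrable_const a), integral_id_gaussianReal]; simp
  have h2 := variance_eq_sub hm
  rw [variance_sub_const (by fun_prop), h, h1] at h2
  simp only [Pi.pow_apply] at h2
  linarith

theorem gaussianReal_eq_withDensity_gaussianReal (μ m : ℝ) {v w : ℝ≥0} (hv : v ≠ 0) (hw : w ≠ 0) :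
    gaussianReal μ v = (gaussianReal m w).withDensity
      (fun y => gaussianPDF μ v y / gaussianPDF m w y) := by
  rw [gaussianReal_of_var_ne_zero _ hv, gaussianReal_of_var_ne_zero _ hw,
    ← withDensity_mul _ (by fun_prop) (by fun_prop)]
  congr 1
  ext y
  simp only [Pi.mul_apply]
  rw [ENNReal.mul_div_cancel (gaussianPDF_pos m hw y).ne' gaussianPDF_ne_top]

theorem log_gaussianPDF_div (μ m y : ℝ) {v w : ℝ≥0} (hv : v ≠ 0) (hw : w ≠ 0) :
    Real.log (gaussianPDF μ v y / gaussianPDF m w y).toReal =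
      1 / 2 * Real.log (w / v) - 1 / (2 * v) * (y - μ) ^ 2 + 1 / (2 * w) * (y - m) ^ 2 := by
  have hv' : (0 : ℝ) < v := by positivity
  have hw' : (0 : ℝ) < w := by positivity
  rw [ENNReal.toReal_div, toReal_gaussianPDF, toReal_gaussianPDF,
    Real.log_div (gaussianPDFReal_pos _ _ _ hv).ne' (gaussianPDFReal_pos _ _ _ hw).ne',
    gaussianPDFReal, gaussianPDFReal, Real.log_mul (by positivity) (Real.exp_pos _).ne',
    Real.log_mul (by positivity) (Real.exp_pos _).ne', Real.log_exp, Real.log_exp, Real.log_inv,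
    Real.log_inv, Real.log_sqrt (by positivity), Real.log_sqrt (by positivity),
    Real.log_mul (by positivity) hv'.ne', Real.log_mul (by positivity) hw'.ne',
    Real.log_div hw'.ne' hv'.ne']
  field_simp
  ring

theorem llr_compProd_gaussianReal {α : Type*} [MeasurableSpace α] (p : Measure α)
    [IsProbabilityMeasure p] (κ : Kernel α ℝ) [IsMarkovKernel κ] {s : α → ℝ} (hs : Measurable s)
    {v V : ℝ≥0} (hv : v ≠ 0) (hV : V ≠ 0) (hκ : ∀ x, κ x = gaussianReal (s x) v) (m : ℝ) :
    p ⊗ₘ κ ≪ p.prod (gaussianReal m V) ∧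
      llr (p ⊗ₘ κ) (p.prod (gaussianReal m V)) =ᵐ[p ⊗ₘ κ] fun z =>
        1 / 2 * Real.log (V / v) - 1 / (2 * v) * (z.2 - s z.1) ^ 2
          + 1 / (2 * V) * (z.2 - m) ^ 2 := by
  let h : α → ℝ → ℝ≥0∞ := fun x y => gaussianPDF (s x) v y / gaussianPDF m V y
  have hh : Measurable (Function.uncurry h) := by
    refine Measurable.div ?_ ((measurable_gaussianPDF m V).comp measurable_snd)
    unfold gaussianPDF gaussianPDFReal
    fun_prop
  have hκh : κ = (Kernel.const _ (gaussianReal m V)).withDensity h := by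
    ext1 x
    rw [Kernel.withDensity_apply _ hh, Kernel.const_apply, hκ,
      gaussianReal_eq_withDensity_gaussianReal _ m hv hV]
  have : IsSFiniteKernel ((Kernel.const α (gaussianReal m V)).withDensity h) :=
    hκh ▸ inferInstance
  have hjoint : p ⊗ₘ κ = (p.prod (gaussianReal m V)).withDensity (fun z => h z.1 z.2) := by
    conv_lhs => rw [hκh]
    rw [Measure.compProd_withDensity hh, Measure.compProd_const]
  have hac : p ⊗ₘ κ ≪ p.prod (gaussianReal m V) :=
    hjoint ▸ withDensity_absolutelyContinuous _ _
  have hr : (p ⊗ₘ κ).rnDeriv (p.prod (gaussianReal m V)) =ᵐ[p.prod (gaussianReal m V)]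
      fun z => h z.1 z.2 := by
    rw [hjoint]
    exact Measure.rnDeriv_withDensity _ hh
  refine ⟨hac, ?_⟩
  filter_upwards [hac.ae_le hr] with z hz
  rw [llr_def]
  exact (congrArg (fun t : ℝ≥0∞ => Real.log t.toReal) hz).trans
    (log_gaussianPDF_div (s z.1) m z.2 hv hV)

theorem integrable_sub_sq_compProd_gaussianReal {α : Type*} [MeasurableSpace α] (p : Measure α)
    [IsProbabilityMeasure p] (κ : Kernel α ℝ) [IsMarkovKernel κ] {s : α → ℝ}
    {v : ℝ≥0} (hκ : ∀ x, κ x = gaussianReal (s x) v) {t : α → ℝ} (ht : Measurable t)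
    (hst : Integrable (fun x => (s x - t x) ^ 2) p) :
    Integrable (fun z : α × ℝ => (z.2 - t z.1) ^ 2) (p ⊗ₘ κ) := by
  rw [Measure.integrable_compProd_iff (by fun_prop)]
  refine ⟨ae_of_all _ fun x => ?_, ?_⟩
  · rw [hκ]
    exact integrable_sub_sq_gaussianReal (s x) (t x) v
  · simp only [norm_pow, Real.norm_eq_abs, sq_abs, hκ, integral_sub_sq_gaussianReal]
    exact (integrable_const _).add hst

theorem integral_sub_sq_compProd_gaussianReal {α : Type*} [MeasurableSpace α] (p : Measure α)
    [IsProbabilityMeasure p] (κ : Kernel α ℝ) [IsMarkovKernel κ] {s : α → ℝ}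
    {v : ℝ≥0} (hκ : ∀ x, κ x = gaussianReal (s x) v) {t : α → ℝ} (ht : Measurable t)
    (hst : Integrable (fun x => (s x - t x) ^ 2) p) :
    ∫ z, (z.2 - t z.1) ^ 2 ∂(p ⊗ₘ κ) = v + ∫ x, (s x - t x) ^ 2 ∂p := by
  rw [Measure.integral_compProd (integrable_sub_sq_compProd_gaussianReal p κ hκ ht hst)]
  simp only [hκ, integral_sub_sq_gaussianReal]
  rw [integral_add (integrable_const _) hst]
  simp

theorem klDiv_compProd_gaussianReal {α : Type*} [MeasurableSpace α] (p : Measure α)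
    [IsProbabilityMeasure p] (κ : Kernel α ℝ) [IsMarkovKernel κ] {s : α → ℝ} (hs : Measurable s)
    (hs2 : MemLp s 2 p) {v V : ℝ≥0} (hv : v ≠ 0) (hV : V ≠ 0)
    (hκ : ∀ x, κ x = gaussianReal (s x) v) (m : ℝ) :
    klDiv (p ⊗ₘ κ) (p.prod (gaussianReal m V)) =
      ENNReal.ofReal (1 / 2 * Real.log (V / v) - 1 / 2 +
        1 / (2 * V) * (v + ∫ x, (s x - m) ^ 2 ∂p)) := by
  obtain ⟨hac, hllr⟩ := llr_compProd_gaussianReal p κ hs hv hV hκ m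
  -- The second-moment lemmas are used twice: centre `s x` isolates the noise, of mean square `v`;
  -- centre `m` gives `v + E(s - m)²`.
  have hss : Integrable (fun x => (s x - s x) ^ 2) p := by simp
  have hsm : Integrable (fun x => (s x - m) ^ 2) p := (hs2.sub (memLp_const m)).integrable_sq
  have hint1 := (integrable_sub_sq_compProd_gaussianReal p κ hκ hs hss).const_mul
    (1 / (2 * (v : ℝ)))
  have hint2 := (integrable_sub_sq_compProd_gaussianReal p κ hκ measurable_const hsm).const_mul
    (1 / (2 * (V : ℝ)))
  have hi1 := integral_sub_sq_compProd_gaussianReal p κ hκ hs hss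
  have hi2 := integral_sub_sq_compProd_gaussianReal p κ hκ measurable_const hsm
  have hA : Integrable (fun z : α × ℝ =>
      1 / 2 * Real.log (V / v) - 1 / (2 * v) * (z.2 - s z.1) ^ 2) (p ⊗ₘ κ) :=
    (integrable_const _).sub hint1
  have hv' : (v : ℝ) ≠ 0 := by exact_mod_cast hv
  rw [klDiv_of_ac_of_integrable hac ((integrable_congr hllr).2 (hA.add hint2)),
    integral_congr_ae hllr]
  congr 1
  rw [integral_add hA hint2, integral_sub (integrable_const _) hint1,
    integral_const_mul (1 / (2 * (v : ℝ))), integral_const_mul (1 / (2 * (V : ℝ))), hi1, hi2]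
  simp
  field_simp

/-! ### Upper bound on the sum capacity -/

namespace MAC

theorem klDiv_compProd_gaussian (k : ℕ) (N : ℝ) (hN : 0 < N) (p : Measure (Fin k → ℝ))
    [IsProbabilityMeasure p] (hs : MemLp (fun x => ∑ j, x j) 2 p) (m : ℝ) {V : ℝ≥0}
    (hV : V ≠ 0) :
    klDiv (p ⊗ₘ (gaussian k N hN).transition) (p.prod (gaussianReal m V)) =
      ENNReal.ofReal (1 / 2 * Real.log (V / N) - 1 / 2 +
        1 / (2 * V) * (N + ∫ x, (∑ j, x j - m) ^ 2 ∂p)) := by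
  have h := klDiv_compProd_gaussianReal p (gaussian k N hN).transition (s := fun x => ∑ j, x j)
    (by fun_prop) hs (by simpa using hN) hV (gaussian_transition_apply k N hN) m
  rwa [Real.coe_toNNReal N hN.le] at h

/-- The total power `∑ j, P j + N` at the output. -/
noncomputable def outputPower {k : ℕ} (N : ℝ) (P : Fin k → ℝ≥0) : ℝ≥0 := ∑ j, P j + N.toNNReal

/-- The sum capacity of the Gaussian MAC. -/
noncomputable def capacity {k : ℕ} (N : ℝ) (P : Fin k → ℝ≥0) : ℝ≥0∞ :=
  ENNReal.ofReal (1 / 2 * Real.log (outputPower N P / N))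

variable {k : ℕ} {N : ℝ} (hN : 0 < N) {P : Fin k → ℝ≥0}

theorem coe_outputPower (hN : 0 < N) : (outputPower N P : ℝ) = ∑ j, (P j : ℝ) + N := by
  simp [outputPower, hN.le]

theorem outputPower_ne_zero (hN : 0 < N) : outputPower N P ≠ 0 := by
  have := coe_outputPower (P := P) hN
  have h : 0 ≤ ∑ j, (P j : ℝ) := Finset.sum_nonneg fun _ _ => NNReal.coe_nonneg _
  intro h0
  rw [h0] at this
  simp only [NNReal.coe_zero] at this
  linarith

/-- The centre `m` is left free: independent inputs need the mean of the sum, the converse needs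
`0`. -/
theorem mutualInfo_add_klDiv_le_capacity (p : Measure (Fin k → ℝ))
    [IsProbabilityMeasure p] (hs : MemLp (fun x => ∑ j, x j) 2 p) (m : ℝ)
    (h : ∫ x, (∑ j, x j - m) ^ 2 ∂p ≤ ∑ j, (P j : ℝ)) :
    (gaussian k N hN).mutualInfo p +
      klDiv ((gaussian k N hN).output p) (gaussianReal m (outputPower N P)) ≤ capacity N P := by
  rw [mutualInfo_add_klDiv_output,
    klDiv_compProd_gaussian k N hN p hs m (outputPower_ne_zero hN)]
  refine ENNReal.ofReal_le_ofReal ?_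
  have hV : (0 : ℝ) < outputPower N P := by
    exact_mod_cast pos_iff_ne_zero.2 (outputPower_ne_zero hN)
  have : 1 / (2 * (outputPower N P : ℝ)) * (N + ∫ x, (∑ j, x j - m) ^ 2 ∂p) ≤ 1 / 2 := by
    rw [div_mul_eq_mul_div, div_le_iff₀ (by positivity), coe_outputPower hN]
    linarith
  linarith

theorem memLp_eval_of_mem_inputDists {p : Measure (Fin k → ℝ)}
    (hp : p ∈ inputDists (powerCost k) P) (j : Fin k) : MemLp (fun x => x j) 2 p := by
  refine ⟨(measurable_pi_apply j).aestronglyMeasurable, ?_⟩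
  rw [eLpNorm_lt_top_iff_lintegral_rpow_enorm_lt_top (by simp) (by simp)]
  refine lt_of_le_of_lt (le_of_eq ?_) ((hp.2 j).trans_lt ENNReal.coe_lt_top)
  refine lintegral_congr fun x => ?_
  simp only [ENNReal.toReal_ofNat, ENNReal.rpow_ofNat]
  rw [← enorm_pow, Real.enorm_of_nonneg (sq_nonneg _), ENNReal.ofReal]
  congr 1
  ext
  rw [Real.coe_toNNReal _ (sq_nonneg _)]
  rfl

theorem memLp_sum_of_mem_inputDists {p : Measure (Fin k → ℝ)}
    (hp : p ∈ inputDists (powerCost k) P) : MemLp (fun x => ∑ j, x j) 2 p :=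
  memLp_finsetSum _ fun j _ => memLp_eval_of_mem_inputDists hp j

theorem integral_sq_le_of_mem_inputDists {p : Measure (Fin k → ℝ)}
    (hp : p ∈ inputDists (powerCost k) P) (j : Fin k) : ∫ x, x j ^ 2 ∂p ≤ P j := by
  rw [integral_eq_lintegral_of_nonneg_ae (ae_of_all _ fun x => sq_nonneg _)
    ((measurable_pi_apply j).pow_const 2).aestronglyMeasurable]
  refine ENNReal.toReal_le_coe_of_le_coe (le_trans (le_of_eq ?_) (hp.2 j))
  refine lintegral_congr fun x => ?_
  rw [ENNReal.ofReal]
  congr 1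
  ext
  rw [Real.coe_toNNReal _ (sq_nonneg _)]
  rfl

theorem mutualInfo_le_capacity {p : Measure (Fin k → ℝ)}
    (hp : p ∈ indInputDists (powerCost k) P) :
    (gaussian k N hN).mutualInfo p ≤ capacity N P := by
  obtain ⟨hp, q, hq, rfl⟩ := hp
  have hs := memLp_sum_of_mem_inputDists hp
  have hmp (j) : MeasurePreserving (fun x : Fin k → ℝ => x j) (Measure.pi q) (q j) :=
    measurePreserving_eval q j
  have hj (j) : MemLp (fun x : ℝ => x) 2 (q j) := by
    rw [← (hmp j).map_eq]
    exact (memLp_map_measure_iff (g := fun y : ℝ => y) (by fun_prop)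
      (hmp j).measurable.aemeasurable).2 (memLp_eval_of_mem_inputDists hp j)
  -- The inputs need not be centred, so a reference output centred at `0` could fail; centring at
  -- the mean leaves a variance.
  refine le_self_add.trans (mutualInfo_add_klDiv_le_capacity hN _ hs
    (∫ x, ∑ j, x j ∂(Measure.pi q)) ?_)
  rw [← variance_eq_integral (by fun_prop)]
  have h := variance_sum_pi (μ := q) hj
  have h' : (∑ i, fun ω : Fin k → ℝ => ω i) = fun ω => ∑ i, ω i := by ext; simp
  rw [h'] at h
  rw [h]
  refine Finset.sum_le_sum fun j _ => ?_
  refine (variance_le_expectation_sq (by fun_prop)).trans ?_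
  refine le_trans (le_of_eq ?_) (integral_sq_le_of_mem_inputDists hp j)
  rw [← (hmp j).map_eq]
  exact integral_map (f := fun y : ℝ => y ^ 2) (hmp j).measurable.aemeasurable (by fun_prop)

end MAC

/-! ### Gaussian inputs attain the capacity -/

theorem map_sum_pi_gaussianReal {ι : Type*} [Fintype ι] (P : ι → ℝ≥0) :
    (Measure.pi fun j => gaussianReal 0 (P j)).map (fun x => ∑ j, x j) =
      gaussianReal 0 (∑ j, P j) := by
  refine Measure.ext_of_charFun ?_
  rw [charFun_map_sum_pi_eq_prod]
  ext t
  rw [Finset.prod_apply]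
  simp_rw [charFun_gaussianReal]
  rw [← Complex.exp_sum]
  congr 1
  simp [Finset.sum_mul, Finset.sum_div]

/-- For `v = 0` the law is a point mass at `0 = √0`; otherwise it has full support. -/
theorem mem_support_gaussianReal_zero_sqrt (v : ℝ≥0) {t : Set ℝ} (ht : t ∈ nhds √(v : ℝ)) :
    0 < gaussianReal 0 v t := by
  rcases eq_or_ne v 0 with rfl | hv
  · rw [gaussianReal_zero_var, Measure.dirac_apply_of_mem (by simpa using mem_of_mem_nhds ht)]
    exact one_pos
  · refine pos_iff_ne_zero.2 fun h => ?_
    exact (volume.measure_pos_of_mem_nhds ht).ne' (gaussianReal_absolutelyContinuous' 0 hv h)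

theorem sum_sq_lt_sq_sum {ι : Type*} [Fintype ι] {a : ι → ℝ} (ha : ∀ i, 0 ≤ a i) {i j : ι}
    (hij : i ≠ j) (hi : 0 < a i) (hj : 0 < a j) : ∑ l, a l ^ 2 < (∑ l, a l) ^ 2 := by
  have hlt : a i < ∑ l, a l := Finset.single_lt_sum hij.symm (Finset.mem_univ i)
    (Finset.mem_univ j) hj fun l _ _ => ha l
  have hle (l) : a l ≤ ∑ l, a l := Finset.single_le_sum (fun l _ => ha l) (Finset.mem_univ l)
  rw [sq (∑ l, a l), Finset.sum_mul]
  refine Finset.sum_lt_sum (fun l _ => ?_) ⟨i, Finset.mem_univ i, ?_⟩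
  · rw [sq]
    exact mul_le_mul_of_nonneg_left (hle l) (ha l)
  · rw [sq]
    exact mul_lt_mul_of_pos_left hlt hi

namespace MAC

variable {k : ℕ} {N : ℝ} (hN : 0 < N) {P : Fin k → ℝ≥0}

theorem gaussian_output_eq_conv (p : Measure (Fin k → ℝ)) [IsProbabilityMeasure p] :
    (gaussian k N hN).output p =
      (p.map fun x => ∑ j, x j) ∗ gaussianReal 0 N.toNNReal := by
  have hs : Measurable fun x : Fin k → ℝ => ∑ j, x j := by fun_prop
  ext t ht
  have ht' : MeasurableSet ((fun z : ℝ × ℝ => z.1 + z.2) ⁻¹' t) :=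
    (measurable_fst.add measurable_snd) ht
  rw [output, Measure.bind_apply ht (Kernel.aemeasurable _), Measure.conv,
    Measure.map_apply (by fun_prop) ht, Measure.prod_apply ht',
    lintegral_map (measurable_measure_prodMk_left ht') hs]
  refine lintegral_congr fun x => ?_
  rw [gaussian_transition_apply]
  have h := gaussianReal_map_const_add (μ := 0) (v := N.toNNReal) (∑ j, x j)
  rw [zero_add] at h
  rw [← h, Measure.map_apply (by fun_prop) ht]
  rfl

theorem output_pi_gaussianReal (P : Fin k → ℝ≥0) :
    (gaussian k N hN).output (Measure.pi fun j => gaussianReal 0 (P j)) =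
      gaussianReal 0 (outputPower N P) := by
  rw [gaussian_output_eq_conv, map_sum_pi_gaussianReal, gaussianReal_conv_gaussianReal,
    add_zero, outputPower]

theorem pi_gaussianReal_mem_indInputDists (P : Fin k → ℝ≥0) :
    (Measure.pi fun j => gaussianReal 0 (P j)) ∈ indInputDists (powerCost k) P := by
  refine ⟨⟨inferInstance, fun j => ?_⟩, _, fun j => inferInstance, rfl⟩
  have hc (y : ℝ) : (powerCost k j y : ℝ≥0∞) = ENNReal.ofReal ((y - 0) ^ 2) := by
    rw [ENNReal.ofReal, sub_zero]
    congr 1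
    ext
    rw [Real.coe_toNNReal _ (sq_nonneg _)]
    rfl
  simp_rw [hc]
  have hm := lintegral_map (μ := Measure.pi fun j => gaussianReal 0 (P j))
    (f := fun y : ℝ => ENNReal.ofReal ((y - 0) ^ 2)) (by fun_prop) (measurable_pi_apply j)
  have he := (measurePreserving_eval (fun j => gaussianReal 0 (P j)) j).map_eq
  refine (hm.symm.trans ?_).le
  refine (congrArg (fun μ => ∫⁻ y, ENNReal.ofReal ((y - 0) ^ 2) ∂μ) he).trans ?_
  rw [← ofReal_integral_eq_lintegral_ofReal (integrable_sub_sq_gaussianReal _ _ _)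
    (ae_of_all _ fun _ => sq_nonneg _), integral_sub_sq_gaussianReal]
  simp

theorem mutualInfo_pi_gaussianReal (P : Fin k → ℝ≥0) :
    (gaussian k N hN).mutualInfo (Measure.pi fun j => gaussianReal 0 (P j)) = capacity N P := by
  have h := mutualInfo_add_klDiv_output k N hN (Measure.pi fun j => gaussianReal 0 (P j))
    (gaussianReal 0 (outputPower N P))
  rw [output_pi_gaussianReal, klDiv_self, add_zero] at h
  have hs := memLp_sum_of_mem_inputDists (pi_gaussianReal_mem_indInputDists P).1
  rw [h, klDiv_compProd_gaussian k N hN _ hs 0 (outputPower_ne_zero hN)]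
  have hi : ∫ x, (∑ j, x j - 0) ^ 2 ∂(Measure.pi fun j => gaussianReal 0 (P j)) =
      ∑ j, (P j : ℝ) := by
    have hm := integral_map (μ := Measure.pi fun j => gaussianReal 0 (P j))
      (φ := fun x => ∑ j, x j) (f := fun y : ℝ => (y - 0) ^ 2)
      (by fun_prop) (by fun_prop)
    rw [← hm, map_sum_pi_gaussianReal, integral_sub_sq_gaussianReal]
    simp
  have hV : (outputPower N P : ℝ) ≠ 0 := by exact_mod_cast outputPower_ne_zero hN
  rw [hi, add_comm N, ← coe_outputPower hN, capacity]
  congr 1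
  field_simp
  ring

theorem isGreatest_capacity (P : Fin k → ℝ≥0) :
    IsGreatest ((gaussian k N hN).mutualInfo '' indInputDists (powerCost k) P)
      (capacity N P) := by
  refine ⟨⟨_, pi_gaussianReal_mem_indInputDists P, mutualInfo_pi_gaussianReal hN P⟩, ?_⟩
  rintro _ ⟨p, hp, rfl⟩
  exact mutualInfo_le_capacity hN hp

/-! ### Two positive powers: a deterministic input as witness -/

theorem dirac_sqrt_mem_inputDists (P : Fin k → ℝ≥0) :
    Measure.dirac (fun j => √(P j : ℝ)) ∈ inputDists (powerCost k) P := by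
  refine ⟨inferInstance, fun j => ?_⟩
  rw [lintegral_dirac]
  refine ENNReal.coe_le_coe.2 (NNReal.coe_le_coe.1 (le_of_eq ?_))
  exact Real.sq_sqrt (NNReal.coe_nonneg _)

theorem sqrt_mem_support_pi_gaussianReal (P : Fin k → ℝ≥0) :
    (fun j => √(P j : ℝ)) ∈ (Measure.pi fun j => gaussianReal 0 (P j)).support := by
  rw [Measure.mem_support_iff_forall]
  intro U hU
  rw [nhds_pi, Filter.mem_pi'] at hU
  obtain ⟨I, t, ht, hIU⟩ := hU
  refine lt_of_lt_of_le ?_ (measure_mono ((Set.pi_mono' (fun _ _ => subset_rfl)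
    (Set.subset_univ _)).trans hIU))
  rw [Measure.pi_pi]
  exact pos_iff_ne_zero.2 <| Finset.prod_ne_zero_iff.2 fun j _ =>
    (mem_support_gaussianReal_zero_sqrt (P j) (ht j)).ne'

theorem gaussian_mem_cStar {i j : Fin k} (hij : i ≠ j) (hi : 0 < P i) (hj : 0 < P j) :
    gaussian k N hN ∈ cStar (powerCost k) P := by
  -- A point mass suffices for `pDep`: it uses full power in each coordinate, and all coordinates
  -- add coherently.
  refine ⟨_, pi_gaussianReal_mem_indInputDists P, _, dirac_sqrt_mem_inputDists P, ?_, ?_, ?_⟩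
  · rw [mutualInfo_pi_gaussianReal]
    exact isGreatest_capacity hN P
  · refine (Measure.support_subset_of_isClosed (isClosed_singleton (x := fun j => √(P j : ℝ)))
      ?_).trans (Set.singleton_subset_iff.2 (sqrt_mem_support_pi_gaussianReal P))
    simp
  · have hs := memLp_sum_of_mem_inputDists (dirac_sqrt_mem_inputDists P)
    have hV : (0 : ℝ) < outputPower N P := by
      exact_mod_cast pos_iff_ne_zero.2 (outputPower_ne_zero hN)
    have hNV : N ≤ outputPower N P := by
      rw [coe_outputPower hN]
      exact le_add_of_nonneg_left (Finset.sum_nonneg fun _ _ => NNReal.coe_nonneg _)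
    rw [mutualInfo_pi_gaussianReal, output_pi_gaussianReal, mutualInfo_add_klDiv_output,
      klDiv_compProd_gaussian k N hN _ hs 0 (outputPower_ne_zero hN), integral_dirac, capacity]
    have hlog : 0 ≤ Real.log (outputPower N P / N) :=
      Real.log_nonneg ((one_le_div hN).2 hNV)
    rw [ENNReal.ofReal_lt_ofReal_iff_of_nonneg (by positivity)]
    have hlt := sum_sq_lt_sq_sum (a := fun j => √(P j : ℝ)) (fun _ => Real.sqrt_nonneg _) hij
      (Real.sqrt_pos.2 hi) (Real.sqrt_pos.2 hj)
    simp only [Real.sq_sqrt (NNReal.coe_nonneg _)] at hlt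
    have : 1 / 2 < 1 / (2 * (outputPower N P : ℝ)) * (N + (∑ j, √(P j : ℝ) - 0) ^ 2) := by
      rw [div_mul_eq_mul_div, lt_div_iff₀ (by positivity), sub_zero, coe_outputPower hN]
      linarith
    linarith

/-! ### At most one positive power: the converse -/

theorem ae_eq_zero_of_power_eq_zero {p : Measure (Fin k → ℝ)}
    (hp : p ∈ inputDists (powerCost k) P) {j : Fin k} (hj : P j = 0) : ∀ᵐ x ∂p, x j = 0 := by
  have := hp.1
  have h := integral_sq_le_of_mem_inputDists hp j
  rw [hj, NNReal.coe_zero] at h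
  have h0 := le_antisymm h (integral_nonneg fun x => sq_nonneg (x j))
  rw [integral_eq_zero_iff_of_nonneg (fun x => sq_nonneg _)
    (memLp_eval_of_mem_inputDists hp j).integrable_sq] at h0
  filter_upwards [h0] with x hx
  simpa using hx

theorem integral_sq_sum_le {p : Measure (Fin k → ℝ)} (hp : p ∈ inputDists (powerCost k) P)
    (hP : ∀ i j, i ≠ j → P i = 0 ∨ P j = 0) :
    ∫ x, (∑ j, x j) ^ 2 ∂p ≤ ∑ j, (P j : ℝ) := by
  have hae : ∀ᵐ x ∂p, ∀ j, P j = 0 → x j = 0 := ae_all_iff.2 fun j => by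
    by_cases hj : P j = 0
    · filter_upwards [ae_eq_zero_of_power_eq_zero hp hj] with x hx _ using hx
    · exact ae_of_all _ fun _ h => absurd h hj
  have hsq : (fun x : Fin k → ℝ => (∑ j, x j) ^ 2) =ᵐ[p] fun x => ∑ j, x j ^ 2 := by
    filter_upwards [hae] with x hx
    rw [sq, Finset.sum_mul]
    refine Finset.sum_congr rfl fun i _ => ?_
    rw [Finset.mul_sum, sq]
    refine Finset.sum_eq_single_of_mem i (Finset.mem_univ i) fun j _ hji => ?_
    rcases hP i j hji.symm with h | h <;> simp [hx _ h]
  rw [integral_congr_ae hsq,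
    integral_finsetSum _ fun j _ => (memLp_eval_of_mem_inputDists hp j).integrable_sq]
  exact Finset.sum_le_sum fun j _ => integral_sq_le_of_mem_inputDists hp j

theorem gaussian_notMem_cStar (hP : ∀ i j, i ≠ j → P i = 0 ∨ P j = 0) :
    gaussian k N hN ∉ cStar (powerCost k) P := by
  rintro ⟨p, hp, p', hp', hmax, -, hlt⟩
  have hbound (r : Measure (Fin k → ℝ)) (hr : r ∈ inputDists (powerCost k) P) :
      (gaussian k N hN).mutualInfo r +
        klDiv ((gaussian k N hN).output r) (gaussianReal 0 (outputPower N P)) ≤ capacity N P := by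
    have := hr.1
    refine mutualInfo_add_klDiv_le_capacity hN r (memLp_sum_of_mem_inputDists hr) 0 ?_
    simpa using integral_sq_sum_le hr hP
  have hcap : (gaussian k N hN).mutualInfo p = capacity N P :=
    hmax.unique (isGreatest_capacity hN P)
  have := hp.1.1
  -- The maximizer `p` is arbitrary. Its mutual information already exhausts the finite bound, so
  -- its output has divergence zero from the Gaussian.
  have hout : (gaussian k N hN).output p = gaussianReal 0 (outputPower N P) := by
    rw [← klDiv_eq_zero_iff]
    have h := hbound p hp.1
    rw [hcap] at h
    have hfin : capacity N P ≠ ∞ := ENNReal.ofReal_ne_top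
    exact nonpos_iff_eq_zero.1 ((ENNReal.add_le_add_iff_left hfin).1 (by simpa using h))
  rw [hout, hcap] at hlt
  exact hlt.not_ge (hbound p' hp')

end MAC

theorem mainTheorem3 (k : ℕ) (N : ℝ) (hN : 0 < N) (P : Fin k → ℝ≥0) :
    MAC.gaussian k N hN ∈ MAC.cStar (MAC.powerCost k) P ↔
      ∃ i j : Fin k, i ≠ j ∧ 0 < P i ∧ 0 < P j := by
  refine ⟨fun h => ?_, fun ⟨i, j, hij, hi, hj⟩ => MAC.gaussian_mem_cStar hN hij hi hj⟩
  by_contra hne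
  refine MAC.gaussian_notMem_cStar hN (fun i j hij => ?_) h
  by_contra! h0
  exact hne ⟨i, j, hij, pos_iff_ne_zero.2 h0.1, pos_iff_ne_zero.2 h0.2⟩
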